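/- For integers $d,c\ge 1$ identify $\mathbb{R}^{c\times d}$ with tuples $x=(x^1,\dots,x^c)$, $x^j\in\mathbb{R}^d$, with the Euclidean norm $\|\cdot\|_2$. For a three-entry kernel $w=(w_{-1},w_0,w_1)\in\mathbb{R}^3$ and $y\in\mathbb{R}^d$ let the zero padding convolution $w\circledast y\in\mathbb{R}^d$ be $(w\circledast y)_i=w_{-1}y_{i-1}+w_0y_i+w_1y_{i+1}$, where $y_0=y_{d+1}=0$. A convolutional layer with $c_1$ input and $c_2$ output channels is a map $f:\mathbb{R}^{c_1\times d}\to\mathbb{R}^{c_2\times d}$, $f^i(x)=\sum_{j=1}^{c_1}w_{i,j}\circledast x^j+\delta_i\mathbf{1}_d$, with kernels $w_{i,j}\in\mathbb{R}^3$ and biases $\delta_i\in\mathbb{R}$. For $\sigma:\mathbb{R}\to\mathbb{R}$, applied componentwise, and $N\ge 1$ let $\Sigma^N_{c,c'}$ be the set of all three-kernel $N$-layered convolutional neural networks $C_N\circ\sigma\circ C_{N-1}\circ\cdots\circ\sigma\circ C_1:\mathbb{R}^{c\times d}\to\mathbb{R}^{c'\times d}$, where the $C_i$ are convolutional layers with arbitrary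 numbers of intermediate channels. For a compact $K\subset\mathbb{R}^{c\times d}$ say that depth $N$ is universal on $K$ if $\overline{\Sigma^N_{c,c'}}=C(K,\mathbb{R}^{c'\times d})$, where the networks are restricted to $K$ and the closure is taken in the norm $\sup_{x\in K}\|f(x)\|_2$. Put $$N_d=\begin{cases}2 & d=1,2,\\ 3 & d=3,\\ d-1 & d\ge 4.\end{cases}$$ Theorem. Let $\sigma:\mathbb{R}\to\mathbb{R}$ be continuous and let $d,c,c'\ge 1$. (1) If $\sigma$ is not a polynomial function, then depth $N_d$ is universal on every compact set $K\subset\mathbb{R}^{c\times d}$. (2) Let $K\subset\mathbb{R}^{c\times d}$ be compact with non-empty interior and, if $d=3$, suppose moreover that the origin is an interior point of $K$. Then no depth $N$ with $1\le N<N_d$ is universal on $K$. In particular, for continuous non-polynomial $\sigma$, $N_d$ is the minimal depth at which three-kernel convolutional neural networks with zero padding have the universal property. -/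

import Mathlib

open scoped BigOperators

namespace CNN

/-- The data space `ℝ^{c × d}` (`c` channels, `d` positions per channel) with the Euclidean norm. -/
abbrev Signal (c d : ℕ) : Type := EuclideanSpace ℝ (Fin c × Fin d)

/-- Infinite-length convolution with kernel `(w_{-k}, …, w_k)`:
`f_i(x) = ∑_{j=-k}^{k} w_j x_{i+j}`. Only the entries of `w` with index in `[-k, k]` are used,
so `w` stands for a vector of `ℝ^{2k+1}`. -/
noncomputable def infConv (k : ℕ) (w : ℤ → ℝ) (x : ℤ → ℝ) : ℤ → ℝ :=
  fun i => ∑ j ∈ Finset.Icc (-(k : ℤ)) (k : ℤ), w j * x (i + j)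

/-- The inclusion `ι : ℝ^d → ℝ^ℤ`: the entries of `x` occupy the positions `1, …, d` and all other
positions are filled with zeros (the entry `x_t`, `1 ≤ t ≤ d`, is stored at index `t - 1` of
`Fin d`). -/
noncomputable def zeroPad {d : ℕ} (x : Fin d → ℝ) : ℤ → ℝ :=
  fun i => if h : 1 ≤ i ∧ i ≤ (d : ℤ) then x ⟨(i - 1).toNat, by omega⟩ else 0

/-- The projection `p_d : ℝ^ℤ → ℝ^d` onto the positions `1, …, d`. -/
def truncate (d : ℕ) (y : ℤ → ℝ) : Fin d → ℝ :=
  fun t => y ((t : ℤ) + 1)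

/-- Zero padding convolution `w ⊛ x = p_d (w * ι x)` on `ℝ^d`, with kernel size `2k+1`. -/
noncomputable def zeroPadConv (k : ℕ) {d : ℕ} (w : ℤ → ℝ) (x : Fin d → ℝ) : Fin d → ℝ :=
  truncate d (infConv k w (zeroPad x))

/-- The zero padding convolutional layer with kernels `W i j` and biases `δ i`:
`f^i(x) = ∑_j W_{i,j} ⊛ x^j + δ_i 𝟏_d`. -/
noncomputable def convLayer (k : ℕ) {c₁ c₂ d : ℕ} (W : Fin c₂ → Fin c₁ → ℤ → ℝ) (δ : Fin c₂ → ℝ) :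
    Signal c₁ d → Signal c₂ d :=
  fun x => WithLp.toLp 2 fun p =>
    (∑ j : Fin c₁, zeroPadConv k (W p.1 j) (fun t => x (j, t)) p.2) + δ p.1

/-- `f` is a zero padding convolutional layer of kernel size `2k+1`. -/
def IsConvLayer (k : ℕ) {c₁ c₂ d : ℕ} (f : Signal c₁ d → Signal c₂ d) : Prop :=
  ∃ (W : Fin c₂ → Fin c₁ → ℤ → ℝ) (δ : Fin c₂ → ℝ), f = convLayer k W δ

/-- Componentwise application of the activation function. -/
noncomputable def act (σ : ℝ → ℝ) {c d : ℕ} (x : Signal c d) : Signal c d :=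
  WithLp.toLp 2 fun p => σ (x p)

/-- `networks σ k c d N c'` is the set `Σ^N_{c,c'}` of the `N`-layered convolutional neural networks
`C_N ∘ σ ∘ C_{N-1} ∘ ⋯ ∘ σ ∘ C_1 : ℝ^{c × d} → ℝ^{c' × d}` with kernel size `2k+1`, where the numbers
of channels of the intermediate layers are arbitrary. There is no network with `0` layers. -/
def networks (σ : ℝ → ℝ) (k c d : ℕ) : ℕ → (c' : ℕ) → Set (Signal c d → Signal c' d)
  | 0, _ => ∅
  | 1, _ => {f | IsConvLayer k f}
  | n + 2, c' => {f | ∃ (m : ℕ) (g : Signal c d → Signal m d) (C : Signal m d → Signal c' d),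
      g ∈ networks σ k c d (n + 1) m ∧ IsConvLayer k C ∧ f = C ∘ act σ ∘ g}

/-- The restrictions to the compact set `K` of the `N`-layered networks, as a subset of
`C(K, ℝ^{c' × d})` with the supremum norm. -/
def networksOn (σ : ℝ → ℝ) (k : ℕ) {c d : ℕ} (K : TopologicalSpace.Compacts (Signal c d))
    (N c' : ℕ) : Set C(K, Signal c' d) :=
  {g | ∃ f ∈ networks σ k c d N c', ∀ x : K, g x = f x}

/-- `N`-layered three-kernel networks with `c'` output channels have the universal property on `K`:
their closure in the supremum norm is all of `C(K, ℝ^{c' × d})`. -/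
def UniversalOn (σ : ℝ → ℝ) {c d : ℕ} (K : TopologicalSpace.Compacts (Signal c d))
    (N c' : ℕ) : Prop :=
  closure (networksOn σ 1 K N c') = Set.univ

/-- The claimed minimal depth: `2` for `d = 1, 2`; `3` for `d = 3`; `d - 1` for `d ≥ 4`. -/
def minDepth (d : ℕ) : ℕ :=
  if d ≤ 2 then 2 else if d = 3 then 3 else d - 1

end CNN

/-!
All functions are considered on the compact set `K`, and the continuous functions `K → ℝ^d` form a
commutative Banach algebra under componentwise multiplication. Networks of a given depth can be run
in parallel, so everything reduces to single output channels, and these form a vector space. Its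
closure for depth `n + 1` is `netsClosure K σ n`.

*Universality.* For a continuous non-polynomial `σ`, the powers of a function `u` lie in the closed
span of the ridge functions `σ(a u + b)` (`pow_mem_of_pointwise_mem`): a mollification `τ` of `σ` is
smooth, `k` derivatives in `a` at `a = 0` give `u ^ k` times the `k`-th derivative of `τ` at `b`, and
if these derivatives vanished for all mollifications, then `σ` would be a limit of polynomials of
degree less than `k`. A closed space containing all powers of the elements of a vector space
contains the algebra generated by it (`adjoin_le_of_pow_mem`). Hence if `F` belongs to the algebra
generated by `netsClosure K σ n`, then `F` and its two shifts belong to `netsClosure K σ (n + 1)`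
(`convOn_mem_of_mem_adjoin`), and `σ` plays no role any more. With `n + 1` layers a position sees
the entries up to `n + 1` positions away (`window_mem`), and the `n` positions nearest to either
boundary can be told apart thanks to the zero padding (`position_mem`). A position that sees all
entries and can be recognized carries arbitrary functions by the Stone–Weierstrass theorem, and one
more layer can shift them to the neighbouring positions (`place_mem_of_position_mem`). This settles
all dimensions except `d = 2`, where a shift leaves a single entry anyway, and `d = 4`, where the
inner positions are not recognized in time and a cancellation is needed
(`netsClosure_eq_top_four`).

*Optimality.* In each case a continuous linear functional vanishes on all networks of smaller depth,
but not on all continuous functions (`not_universalOn_of_functional`). For `N = 1` it is a second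
difference. For `N ≤ d - 2` it is a difference in the direction of the last entry, on which the
first output entry does not depend. For `d = 3` it comes from the relation
`f₁(0, ε, 0) - f₁(0) = f₂(0, 0, ε) - f₂(0)`.
-/

namespace CNN

open MeasureTheory Filter Topology

/-! ### Polynomials and pointwise limits -/

section PolynomialLimits

theorem exists_coeff_of_iteratedDeriv_eq_zero (k : ℕ) (f : ℝ → ℝ) (hf : ContDiff ℝ (⊤ : ℕ∞) f)
    (h : ∀ x, iteratedDeriv k f x = 0) :
    ∃ a : ℕ → ℝ, ∀ t, f t = ∑ i ∈ Finset.range k, a i * t ^ i := by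
  induction k generalizing f with
  | zero => exact ⟨0, fun t => by simpa using h t⟩
  | succ k ih =>
    have hf' : ContDiff ℝ (⊤ : ℕ∞) (deriv f) :=
      ((contDiff_succ_iff_deriv (n := ((⊤ : ℕ∞) : WithTop ℕ∞))).1 (by simpa using hf)).2.2
    obtain ⟨a, ha⟩ := ih (deriv f) hf' (fun x => by rw [← iteratedDeriv_succ']; exact h x)
    have hd : ∀ t, HasDerivAt
        (fun s => f s - ∑ i ∈ Finset.range k, a i / (i + 1) * s ^ (i + 1)) 0 t := by
      intro t
      have h1 : HasDerivAt f (deriv f t) t :=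
        (hf.differentiable (by simp)).differentiableAt.hasDerivAt
      have h2 : HasDerivAt (fun s : ℝ => ∑ i ∈ Finset.range k, a i / (i + 1) * s ^ (i + 1))
          (∑ i ∈ Finset.range k, a i * t ^ i) t := by
        refine HasDerivAt.fun_sum fun i _ => ?_
        have h3 := (hasDerivAt_pow (i + 1) t).const_mul (a i / ((i : ℝ) + 1))
        refine h3.congr_deriv ?_
        have : (i : ℝ) + 1 ≠ 0 := by positivity
        rw [Nat.add_sub_cancel]
        push_cast
        field_simp
      have h3 := h1.fun_sub h2
      rwa [ha t, sub_self] at h3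
    have hc := is_const_of_deriv_eq_zero (fun t => (hd t).differentiableAt)
      (fun t => (hd t).deriv)
    refine ⟨fun i => if i = 0 then f 0 else a (i - 1) / i, fun t => ?_⟩
    have := hc t 0
    simp only [zero_pow (Nat.succ_ne_zero _), mul_zero, Finset.sum_const_zero, sub_zero] at this
    rw [Finset.sum_range_succ']
    simp only [Nat.add_eq_zero_iff, one_ne_zero, and_false, if_false, if_true, pow_zero, mul_one,
      Nat.add_sub_cancel, Nat.cast_add, Nat.cast_one]
    linarith

/-- Polynomials of degree less than `k` are closed under pointwise limits: such a polynomial is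
the Lagrange interpolation of its values at `k` nodes. -/
theorem exists_polynomial_of_tendsto {α : Type*} {l : Filter α} [l.NeBot] (k : ℕ)
    (a : α → ℕ → ℝ) (f : ℝ → ℝ)
    (h : ∀ t, Tendsto (fun s => ∑ i ∈ Finset.range k, a s i * t ^ i) l (𝓝 (f t))) :
    ∃ p : Polynomial ℝ, ∀ t, f t = p.eval t := by
  set P : α → Polynomial ℝ := fun s =>
    ∑ i ∈ Finset.range k, Polynomial.C (a s i) * Polynomial.X ^ i with hP
  have hPe : ∀ s t, (P s).eval t = ∑ i ∈ Finset.range k, a s i * t ^ i := by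
    intro s t
    simp [hP, Polynomial.eval_finsetSum]
  have hPd : ∀ s, (P s).degree < (Finset.range k).card := by
    intro s
    rw [Finset.card_range, ← Polynomial.mem_degreeLT]
    refine Submodule.sum_mem _ fun i hi => ?_
    rw [Polynomial.mem_degreeLT]
    exact lt_of_le_of_lt (Polynomial.degree_C_mul_X_pow_le _ _)
      (by exact_mod_cast Finset.mem_range.1 hi)
  have hinj : Set.InjOn (fun i : ℕ => (i : ℝ)) (Finset.range k : Set ℕ) :=
    fun i _ j _ hij => Nat.cast_injective hij
  refine ⟨Lagrange.interpolate (Finset.range k) (fun i : ℕ => (i : ℝ)) (fun i => f i), fun t => ?_⟩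
  have h1 : ∀ s, (P s).eval t = ∑ i ∈ Finset.range k, (P s).eval (i : ℝ) *
      (Lagrange.basis (Finset.range k) (fun i : ℕ => (i : ℝ)) i).eval t := by
    intro s
    conv_lhs => rw [Lagrange.eq_interpolate hinj (hPd s)]
    simp [Lagrange.interpolate_apply, Polynomial.eval_finsetSum]
  refine tendsto_nhds_unique (h t) ?_
  simp only [Lagrange.interpolate_apply, Polynomial.eval_finsetSum, Polynomial.eval_mul,
    Polynomial.eval_C]
  simp only [← hPe]
  rw [show (fun s => (P s).eval t) = _ from funext h1]
  refine tendsto_finsetSum _ fun i _ => Tendsto.mul_const _ ?_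
  simpa only [hPe] using h i

end PolynomialLimits

/-! ### Powers as limits of ridge functions -/

section Ridge

theorem integral_mem_of_isClosed {E : Type*} [NormedAddCommGroup E] [NormedSpace ℝ E]
    [CompleteSpace E] (M : Submodule ℝ E) (hM : IsClosed (M : Set E)) (F : ℝ → E)
    (hF : Integrable F) (h : ∀ s, F s ∈ M) : ∫ s, F s ∈ M := by
  have hM' : CompleteSpace M := hM.completeSpace_coe
  let F' : ℝ → M := fun s => ⟨F s, h s⟩
  have hF' : Integrable F' :=
    hF.mono ((M.subtypeₗᵢ.isometry.isEmbedding.aestronglyMeasurable_comp_iff (f := F')).1 hF.1)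
      (Eventually.of_forall fun s => le_rfl)
  have : ∫ s, F s = ((∫ s, F' s : M) : E) := M.subtypeₗᵢ.integral_comp_comm F'
  rw [this]
  exact (∫ s, F' s : M).2

variable {X ι : Type*} [TopologicalSpace X] [CompactSpace X] [Fintype ι]

/-- The composition of `f` with each component of `u`. -/
def pointwise {X ι : Type*} [TopologicalSpace X] (f : C(ℝ, ℝ)) (u : C(X, ι → ℝ)) : C(X, ι → ℝ) :=
  ⟨fun x i => f (u x i), by fun_prop⟩

@[simp]
theorem pointwise_apply {X ι : Type*} [TopologicalSpace X] (f : C(ℝ, ℝ)) (u : C(X, ι → ℝ))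
    (x : X) (i : ι) :
    pointwise f u x i = f (u x i) := rfl

/-- The convolution of `σ` with a test function is a superposition of translates of `σ`, so that a
closed subspace stable under these translates contains it. -/
theorem pointwise_convolution_mem (M : Submodule ℝ C(X, ι → ℝ))
    (hM : IsClosed (M : Set C(X, ι → ℝ)))
    (u : C(X, ι → ℝ)) (σ τ : C(ℝ, ℝ)) (φ : ℝ → ℝ) (hφ : Continuous φ) (hφc : HasCompactSupport φ)
    (hτ : ∀ x, τ x = ∫ s, φ s * σ (x - s))
    (h : ∀ a b : ℝ, pointwise σ (a • u + b • 1) ∈ M) (a b : ℝ) :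
    pointwise τ (a • u + b • 1) ∈ M := by
  have hcont : Continuous fun s : ℝ => pointwise σ (a • u + (b - s) • 1) := by
    refine ContinuousMap.continuous_of_continuous_uncurry _ ?_
    refine continuous_pi fun i => ?_
    simp only [Function.uncurry_def, pointwise_apply, ContinuousMap.add_apply,
      ContinuousMap.smul_apply, ContinuousMap.one_apply, Pi.add_apply, Pi.smul_apply, Pi.one_apply]
    fun_prop
  let F : ℝ → C(X, ι → ℝ) := fun s => φ s • pointwise σ (a • u + (b - s) • 1)
  have hF : Continuous F := hφ.smul hcont
  have hFi : Integrable F := hF.integrable_of_hasCompactSupport hφc.smul_right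
  have key : pointwise τ (a • u + b • 1) = ∫ s, F s := by
    ext x i
    have h1 := (((ContinuousLinearMap.proj (R := ℝ) (φ := fun _ : ι => ℝ) i).comp
      (ContinuousMap.evalCLM ℝ x)).integral_comp_comm hFi).symm
    refine Eq.trans ?_ h1.symm
    rw [pointwise_apply, hτ]
    refine integral_congr_ae (Eventually.of_forall fun s => ?_)
    change φ s * σ (a * u x i + b * 1 - s) = φ s * σ (a * u x i + (b - s) * 1)
    ring_nf
  rw [key]
  exact integral_mem_of_isClosed M hM F hFi fun s => M.smul_mem _ (h a (b - s))

/-- The derivative of `a ↦ u ^ k f(a u + b)` is a limit of difference quotients, taken uniformly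
on `X`, and thus stays in a closed subspace. -/
theorem pow_mul_pointwise_deriv_mem {X ι : Type*} [TopologicalSpace X] (M : Submodule ℝ C(X, ι → ℝ))
    (hM : IsClosed (M : Set C(X, ι → ℝ))) (u : C(X, ι → ℝ)) (k : ℕ) (f f' : C(ℝ, ℝ))
    (hf : ∀ x, HasDerivAt f (f' x) x)
    (h : ∀ a b : ℝ, u ^ k * pointwise f (a • u + b • 1) ∈ M) (a b : ℝ) :
    u ^ (k + 1) * pointwise f' (a • u + b • 1) ∈ M := by
  -- `G h` is the difference quotient for `h ≠ 0` and the derivative for `h = 0`; the integral form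
  -- makes it continuous in `h`
  let G : ℝ → C(X, ι → ℝ) := fun h =>
    ⟨fun x i => u x i ^ (k + 1) * ∫ s in (0 : ℝ)..1, f' (a * u x i + b + s * (h * u x i)), by
      refine continuous_pi fun i => Continuous.mul (by fun_prop) ?_
      refine intervalIntegral.continuous_parametric_intervalIntegral_of_continuous'
        (f := fun (x : X) (s : ℝ) => f' (a * u x i + b + s * (h * u x i))) ?_ 0 1
      simp only [Function.uncurry_def]
      fun_prop⟩
  have hG : Continuous G := by
    refine ContinuousMap.continuous_of_continuous_uncurry _ ?_
    refine continuous_pi fun i => Continuous.mul (by fun_prop) ?_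
    refine intervalIntegral.continuous_parametric_intervalIntegral_of_continuous'
      (f := fun (q : ℝ × X) (s : ℝ) => f' (a * u q.2 i + b + s * (q.1 * u q.2 i))) ?_ 0 1
    simp only [Function.uncurry_def]
    fun_prop
  have h0 : G 0 = u ^ (k + 1) * pointwise f' (a • u + b • 1) := by
    ext x i
    simp [G]
  have hne : ∀ t : ℝ, t ≠ 0 → G t ∈ M := by
    intro t ht
    have : G t = t⁻¹ • (u ^ k * pointwise f ((a + t) • u + b • 1)
        - u ^ k * pointwise f (a • u + b • 1)) := by
      ext x i
      have hd : ∀ s ∈ Set.uIcc (0 : ℝ) 1, HasDerivAt (fun s => f (a * u x i + b + s * (t * u x i)))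
          (f' (a * u x i + b + s * (t * u x i)) * (t * u x i)) s := by
        intro s _
        have h1 : HasDerivAt (fun s : ℝ => a * u x i + b + s * (t * u x i)) (t * u x i) s := by
          simpa using ((hasDerivAt_id s).mul_const (t * u x i)).const_add (a * u x i + b)
        exact (hf _).comp s h1
      have hI := intervalIntegral.integral_eq_sub_of_hasDerivAt hd
        (Continuous.intervalIntegrable (by fun_prop) 0 1)
      rw [intervalIntegral.integral_mul_const] at hI
      simp only [G, ContinuousMap.coe_mk, ContinuousMap.smul_apply, ContinuousMap.sub_apply,
        ContinuousMap.mul_apply, ContinuousMap.pow_apply, Pi.smul_apply, Pi.sub_apply,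
        Pi.mul_apply, Pi.pow_apply, pointwise_apply, ContinuousMap.add_apply, Pi.add_apply,
        ContinuousMap.one_apply, Pi.one_apply, smul_eq_mul, mul_one]
      have e1 : (a + t) * u x i + b = a * u x i + b + 1 * (t * u x i) := by ring
      have e2 : a * u x i + b = a * u x i + b + 0 * (t * u x i) := by ring
      rw [e1, ← mul_sub]
      conv_rhs => rw [e2]
      simp only [add_zero, zero_mul] at hI ⊢
      rw [← hI, pow_succ]
      generalize (∫ s in (0 : ℝ)..1, f' (a * u x i + b + s * (t * u x i))) = I
      field_simp
    rw [this]
    exact M.smul_mem _ (M.sub_mem (h _ _) (h _ _))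
  rw [← h0]
  have hcl : IsClosed (G ⁻¹' (M : Set C(X, ι → ℝ))) := hM.preimage hG
  have hd : Dense ({0}ᶜ : Set ℝ) := dense_compl_singleton 0
  have : closure ({0}ᶜ : Set ℝ) ⊆ G ⁻¹' (M : Set C(X, ι → ℝ)) :=
    hcl.closure_subset_iff.2 fun t ht => hne t ht
  exact this (hd 0)

/-- A closed subspace containing the ridge functions `σ(a u + b)` of a continuous non-polynomial
`σ` contains all powers of `u`. -/
theorem pow_mem_of_pointwise_mem (M : Submodule ℝ C(X, ι → ℝ))
    (hM : IsClosed (M : Set C(X, ι → ℝ))) (u : C(X, ι → ℝ)) (σ : C(ℝ, ℝ))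
    (hσ : ¬ ∃ p : Polynomial ℝ, ∀ t : ℝ, σ t = p.eval t)
    (h : ∀ a b : ℝ, pointwise σ (a • u + b • 1) ∈ M) (k : ℕ) : u ^ k ∈ M := by
  by_contra hk
  apply hσ
  let φ : ℕ → ContDiffBump (0 : ℝ) := fun n =>
    ⟨1 / (2 * ((n : ℝ) + 1)), 1 / ((n : ℝ) + 1), by positivity, by
      apply one_div_lt_one_div_of_lt <;> [positivity; linarith [n.cast_nonneg (α := ℝ)]]⟩
  have hφr : Tendsto (fun n => (φ n).rOut) atTop (𝓝 0) := tendsto_one_div_add_atTop_nhds_zero_nat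
  let τ : ℕ → ℝ → ℝ := fun n =>
    convolution ((φ n).normed volume) σ (ContinuousLinearMap.lsmul ℝ ℝ) volume
  have hτ : ∀ n, ContDiff ℝ (⊤ : ℕ∞) (τ n) := fun n =>
    (φ n).hasCompactSupport_normed.contDiff_convolution_left _ (φ n).contDiff_normed
      σ.continuous.locallyIntegrable
  -- differentiating `k` times yields `u ^ k τ⁽ᵏ⁾(a u + b)`, and `a = 0` isolates the power
  have hgood : ∀ n j, ∃ g : C(ℝ, ℝ), (∀ x, g x = iteratedDeriv j (τ n) x) ∧
      ∀ a b : ℝ, u ^ j * pointwise g (a • u + b • 1) ∈ M := by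
    intro n j
    induction j with
    | zero =>
      refine ⟨⟨τ n, (hτ n).continuous⟩, fun x => by simp, fun a b => ?_⟩
      rw [pow_zero, one_mul]
      exact pointwise_convolution_mem M hM u σ _ ((φ n).normed volume) (φ n).continuous_normed
        (φ n).hasCompactSupport_normed (fun x => by
          simp [τ, convolution_def]) h a b
    | succ j ih =>
      obtain ⟨g, hg, hgM⟩ := ih
      have hge : (g : ℝ → ℝ) = iteratedDeriv j (τ n) := funext hg
      refine ⟨⟨iteratedDeriv (j + 1) (τ n),
        (hτ n).continuous_iteratedDeriv _ (by exact_mod_cast le_top)⟩,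
        fun x => rfl, fun a b => ?_⟩
      refine pow_mul_pointwise_deriv_mem M hM u j g _ (fun x => ?_) hgM a b
      rw [hge, ContinuousMap.coe_mk, iteratedDeriv_succ]
      exact ((hτ n).differentiable_iteratedDeriv j
        (by exact_mod_cast WithTop.coe_lt_top j)).differentiableAt.hasDerivAt
  have hzero : ∀ n x, iteratedDeriv k (τ n) x = 0 := by
    intro n x
    by_contra hx
    obtain ⟨g, hg, hgM⟩ := hgood n k
    apply hk
    have := M.smul_mem (g x)⁻¹ (hgM 0 x)
    convert this using 1
    ext y i
    have hgx : g x ≠ 0 := by rwa [hg]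
    simp [hgx, mul_comm]
  choose a ha using fun n => exists_coeff_of_iteratedDeriv_eq_zero k (τ n) (hτ n) (hzero n)
  refine exists_polynomial_of_tendsto (l := atTop) k a σ fun t => ?_
  simp_rw [← ha]
  exact ContDiffBump.convolution_tendsto_right_of_continuous hφr σ.continuous t

end Ridge

/-! ### Closed subspaces containing all powers -/

/-- If a closed subspace `A` contains all powers of the elements of a subspace `V`, then it contains
the subalgebra generated by `V`: the span of the exponentials of elements of `V` is an
algebra contained in `A`, and its closure contains `V`. -/
theorem adjoin_le_of_pow_mem {E : Type*} [NormedCommRing E] [NormedAlgebra ℝ E] [CompleteSpace E]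
    (V A : Submodule ℝ E) (hA : IsClosed (A : Set E)) (h : ∀ u ∈ V, ∀ k : ℕ, u ^ k ∈ A) :
    Subalgebra.toSubmodule (Algebra.adjoin ℝ (V : Set E)) ≤ A := by
  let _ : NormedAlgebra ℚ E := NormedAlgebra.restrictScalars ℚ ℝ E
  have hexp : ∀ u ∈ V, NormedSpace.exp u ∈ A := fun u hu =>
    hA.mem_of_tendsto (NormedSpace.exp_series_hasSum_exp' (𝕂 := ℝ) u)
      (Eventually.of_forall fun s => A.sum_mem fun n _ => A.smul_mem _ (h u hu n))
  let S : Submonoid E :=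
    { carrier := {e | ∃ u ∈ V, NormedSpace.exp u = e}
      one_mem' := ⟨0, V.zero_mem, NormedSpace.exp_zero⟩
      mul_mem' := by
        rintro _ _ ⟨u, hu, rfl⟩ ⟨v, hv, rfl⟩
        exact ⟨u + v, V.add_mem hu hv, NormedSpace.exp_add⟩ }
  let D : Subalgebra ℝ E := Algebra.adjoin ℝ (S : Set E)
  have hD : (D : Set E) ⊆ A := by
    intro x hx
    have : x ∈ Subalgebra.toSubmodule (Algebra.adjoin ℝ (S : Set E)) := hx
    rw [Algebra.adjoin_eq_span, Submonoid.closure_eq] at this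
    refine (Submodule.span_le (p := A)).2 ?_ this
    rintro _ ⟨u, hu, rfl⟩
    exact hexp u hu
  have hVD : Algebra.adjoin ℝ (V : Set E) ≤ D.topologicalClosure := by
    refine Algebra.adjoin_le fun u hu => ?_
    have hd := (hasDerivAt_exp_smul_const (𝕂 := ℝ) u (0 : ℝ)).tendsto_slope
    simp only [zero_smul, NormedSpace.exp_zero, one_mul] at hd
    refine mem_closure_of_tendsto hd (Eventually.of_forall fun t => ?_)
    have he : ∀ t : ℝ, NormedSpace.exp (t • u) ∈ D := fun t =>
      Algebra.subset_adjoin ⟨t • u, V.smul_mem t hu, rfl⟩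
    simp only [slope_def_module]
    exact D.smul_mem (D.sub_mem (he t) (he 0)) _
  intro x hx
  exact closure_minimal hD hA (hVD hx)

/-! ### Three-entry zero padding convolution -/

section Convolution

variable {d : ℕ}

theorem zeroPadConv_one_apply (w : ℤ → ℝ) (y : Fin d → ℝ) (t : Fin d) :
    zeroPadConv 1 w y t =
      w (-1) * zeroPad y t + w 0 * zeroPad y (t + 1) + w 1 * zeroPad y (t + 2) := by
  have h : Finset.Icc (-((1 : ℕ) : ℤ)) ((1 : ℕ) : ℤ) = {-1, 0, 1} := by decide
  simp only [zeroPadConv, truncate, infConv, h]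
  rw [Finset.sum_insert (by decide), Finset.sum_insert (by decide), Finset.sum_singleton]
  have e1 : (t : ℤ) + 1 + -1 = t := by ring
  have e2 : (t : ℤ) + 1 + 1 = t + 2 := by ring
  rw [e1, e2, add_zero, add_assoc]

theorem zeroPad_of_mem (y : Fin d → ℝ) (i : ℤ) (s : Fin d) (h : i = s + 1) :
    zeroPad y i = y s := by
  subst h
  have : 1 ≤ (s : ℤ) + 1 ∧ (s : ℤ) + 1 ≤ d := by omega
  rw [zeroPad, dif_pos this]
  congr 1
  ext
  simp

theorem zeroPad_of_notMem (y : Fin d → ℝ) (i : ℤ) (h : i < 1 ∨ (d : ℤ) < i) :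
    zeroPad y i = 0 := by
  rw [zeroPad, dif_neg (by omega)]

theorem zeroPad_add (y z : Fin d → ℝ) (i : ℤ) : zeroPad (y + z) i = zeroPad y i + zeroPad z i := by
  unfold zeroPad
  split_ifs <;> simp

theorem zeroPad_smul (a : ℝ) (y : Fin d → ℝ) (i : ℤ) : zeroPad (a • y) i = a * zeroPad y i := by
  unfold zeroPad
  split_ifs <;> simp

/-- The zero padding convolution with a three-entry kernel, as a continuous linear map. -/
noncomputable def convCLM (w : ℤ → ℝ) : (Fin d → ℝ) →L[ℝ] (Fin d → ℝ) :=
  LinearMap.toContinuousLinearMap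
    { toFun := zeroPadConv 1 w
      map_add' := fun y z => by
        ext t
        simp only [zeroPadConv_one_apply, zeroPad_add, Pi.add_apply]
        ring
      map_smul' := fun a y => by
        ext t
        simp only [zeroPadConv_one_apply, zeroPad_smul, Pi.smul_apply, smul_eq_mul,
          RingHom.id_apply]
        ring }

theorem convCLM_apply (w : ℤ → ℝ) (y : Fin d → ℝ) : convCLM w y = zeroPadConv 1 w y := rfl

theorem zeroPadConv_sum_kernel {ι : Type*} (s : Finset ι) (w : ι → ℤ → ℝ) (y : Fin d → ℝ)
    (t : Fin d) : zeroPadConv 1 (∑ i ∈ s, w i) y t = ∑ i ∈ s, zeroPadConv 1 (w i) y t := by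
  simp only [zeroPadConv_one_apply, Finset.sum_apply, Finset.sum_mul, Finset.sum_add_distrib]

theorem zeroPadConv_smul_kernel (a : ℝ) (w : ℤ → ℝ) (y : Fin d → ℝ) (t : Fin d) :
    zeroPadConv 1 (a • w) y t = a * zeroPadConv 1 w y t := by
  simp only [zeroPadConv_one_apply, Pi.smul_apply, smul_eq_mul]
  ring

theorem zeroPadConv_zero_kernel (y : Fin d → ℝ) (t : Fin d) : zeroPadConv 1 0 y t = 0 := by
  simp [zeroPadConv_one_apply]

theorem zeroPadConv_single_zero (y : Fin d → ℝ) : zeroPadConv 1 (Pi.single 0 1) y = y := by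
  ext t
  simp [zeroPadConv_one_apply, zeroPad_of_mem y _ t rfl]

/-- The kernel `Pi.single m 1` shifts by `m` positions. -/
theorem zeroPadConv_single (m : ℤ) (hm : |m| ≤ 1) (y : Fin d → ℝ) (t : Fin d) :
    zeroPadConv 1 (Pi.single m 1) y t = zeroPad y (t + 1 + m) := by
  rw [abs_le] at hm
  obtain h | h | h : m = -1 ∨ m = 0 ∨ m = 1 := by omega
  · subst h
    simp [zeroPadConv_one_apply]
  · subst h
    simp [zeroPadConv_one_apply]
  · subst h
    simp [zeroPadConv_one_apply, add_assoc]

end Convolution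

/-! ### Single output channels of networks -/

section ChannelNets

variable {c d : ℕ}

/-- The single-channel outputs `∑ wᵢ ⊛ hᵢ + δ 𝟏` of a convolutional layer fed with channels from
`H`. -/
noncomputable def convSpan {S : Type*} (H : Set (S → Fin d → ℝ)) : Submodule ℝ (S → Fin d → ℝ) :=
  Submodule.span ℝ ({f | ∃ w, ∃ h ∈ H, f = fun x => zeroPadConv 1 w (h x)} ∪ {1})

/-- The single output channels of the networks with `n + 1` layers. Since the number of
intermediate channels is arbitrary, they form a vector space. -/
noncomputable def channelNets (σ : ℝ → ℝ) (c d : ℕ) : ℕ → Submodule ℝ (Signal c d → Fin d → ℝ)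
  | 0 => convSpan (Set.range fun (j : Fin c) (x : Signal c d) (t : Fin d) => x (j, t))
  | n + 1 => convSpan ((fun (g : Signal c d → Fin d → ℝ) x t => σ (g x t)) ''
      (channelNets σ c d n : Set (Signal c d → Fin d → ℝ)))

theorem exists_sum_of_mem_convSpan {S : Type*} {H : Set (S → Fin d → ℝ)} {f : S → Fin d → ℝ}
    (hf : f ∈ convSpan H) :
    ∃ (m : ℕ) (h : Fin m → S → Fin d → ℝ) (W : Fin m → ℤ → ℝ) (δ : ℝ), (∀ i, h i ∈ H) ∧
      ∀ x t, f x t = ∑ i, zeroPadConv 1 (W i) (h i x) t + δ := by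
  induction hf using Submodule.span_induction with
  | mem f hf =>
    rcases hf with ⟨w, h, hh, rfl⟩ | rfl
    · exact ⟨1, fun _ => h, fun _ => w, 0, fun _ => hh, fun x t => by simp⟩
    · exact ⟨0, Fin.elim0, Fin.elim0, 1, fun i => i.elim0, fun x t => by simp⟩
  | zero => exact ⟨0, Fin.elim0, Fin.elim0, 0, fun i => i.elim0, fun x t => by simp⟩
  | add f g _ _ hf hg =>
    obtain ⟨m, h, W, δ, hh, hf⟩ := hf
    obtain ⟨m', h', W', δ', hh', hg⟩ := hg
    refine ⟨m + m', Fin.append h h', Fin.append W W', δ + δ', fun i => ?_, fun x t => ?_⟩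
    · induction i using Fin.addCases <;> simp [hh, hh']
    · rw [Pi.add_apply, Pi.add_apply, hf, hg, Fin.sum_univ_add]
      simp only [Fin.append_left, Fin.append_right]
      ring
  | smul a f _ hf =>
    obtain ⟨m, h, W, δ, hh, hf⟩ := hf
    refine ⟨m, h, fun i => a • W i, a * δ, hh, fun x t => ?_⟩
    rw [Pi.smul_apply, Pi.smul_apply, hf, smul_eq_mul, mul_add, Finset.mul_sum]
    simp only [zeroPadConv_smul_kernel]

theorem one_mem_channelNets (σ : ℝ → ℝ) (n : ℕ) : 1 ∈ channelNets σ c d n := by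
  cases n <;> exact Submodule.subset_span (Or.inr rfl)

theorem conv_mem_channelNets_zero (σ : ℝ → ℝ) (w : ℤ → ℝ) (j : Fin c) :
    (fun x t => zeroPadConv 1 w (fun s => x (j, s)) t) ∈ channelNets σ c d 0 :=
  Submodule.subset_span (Or.inl ⟨w, _, ⟨j, rfl⟩, rfl⟩)

theorem conv_mem_channelNets_succ (σ : ℝ → ℝ) (w : ℤ → ℝ) {n : ℕ} {g : Signal c d → Fin d → ℝ}
    (hg : g ∈ channelNets σ c d n) :
    (fun x t => zeroPadConv 1 w (fun s => σ (g x s)) t) ∈ channelNets σ c d (n + 1) :=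
  Submodule.subset_span (Or.inl ⟨w, _, ⟨g, hg, rfl⟩, rfl⟩)

/-- Networks of the same depth can be run in parallel. -/
theorem stack_mem_networks (σ : ℝ → ℝ) (n c' : ℕ) (f : Fin c' → Signal c d → Fin d → ℝ)
    (hf : ∀ i, f i ∈ channelNets σ c d n) :
    (fun x => WithLp.toLp 2 fun p : Fin c' × Fin d => f p.1 x p.2) ∈
      networks σ 1 c d (n + 1) c' := by
  induction n generalizing c' with
  | zero =>
    choose m h W δ hh hf' using fun i => exists_sum_of_mem_convSpan (hf i)
    choose J hJ using hh
    refine ⟨fun i j => ∑ q with J i q = j, W i q, δ, ?_⟩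
    funext x
    simp only [convLayer]
    congr 1
    funext p
    rw [hf']
    simp only [zeroPadConv_sum_kernel]
    congr 1
    rw [← Finset.sum_fiberwise Finset.univ (J p.1)]
    refine Finset.sum_congr rfl fun j _ => Finset.sum_congr rfl fun q hq => ?_
    rw [← hJ, (Finset.mem_filter.1 hq).2]
  | succ n ih =>
    choose m h W δ hh hf' using fun i => exists_sum_of_mem_convSpan (hf i)
    choose g hg hgh using hh
    let e : (Σ i : Fin c', Fin (m i)) ≃ Fin (∑ i, m i) := finSigmaFinEquiv
    refine ⟨∑ i, m i, _, convLayer 1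
      (fun i q => if (e.symm q).1 = i then W _ (e.symm q).2 else 0) δ,
      ih _ (fun q => g (e.symm q).1 (e.symm q).2) (fun q => hg _ _), ⟨_, _, rfl⟩, ?_⟩
    funext x
    simp only [convLayer, Function.comp_apply, act]
    congr 1
    funext p
    rw [hf']
    congr 1
    rw [← e.sum_comp, Fintype.sum_sigma, Finset.sum_eq_single p.1]
    · refine Finset.sum_congr rfl fun q _ => ?_
      rw [Equiv.symm_apply_apply, if_pos rfl, ← hgh]
    · intro i _ hi
      refine Finset.sum_eq_zero fun q _ => ?_
      rw [Equiv.symm_apply_apply, if_neg hi, zeroPadConv_zero_kernel]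
    · simp

end ChannelNets

/-! ### Uniform closures of the single output channels -/

section Closure

variable {c d : ℕ} (K : TopologicalSpace.Compacts (Signal c d))

/-- The continuous functions on `K` given by single output channels of networks with `n + 1`
layers. -/
noncomputable def netsOn (σ : ℝ → ℝ) (n : ℕ) : Submodule ℝ C(K, Fin d → ℝ) :=
  ((channelNets σ c d n).map
    (LinearMap.funLeft ℝ (Fin d → ℝ) ((↑) : K → Signal c d))).comap (ContinuousMap.coeFnLinearMap ℝ)

variable {K}

theorem mem_netsOn {σ : ℝ → ℝ} {n : ℕ} {F : C(K, Fin d → ℝ)} :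
    F ∈ netsOn K σ n ↔ ∃ f ∈ channelNets σ c d n, ∀ x : K, f x = F x := by
  simp only [netsOn, Submodule.mem_comap, Submodule.mem_map]
  refine exists_congr fun f => and_congr_right fun _ => ?_
  exact funext_iff

variable (K)

/-- The uniform closure of the single output channels of networks with `n + 1` layers. -/
noncomputable def netsClosure (σ : ℝ → ℝ) (n : ℕ) : Submodule ℝ C(K, Fin d → ℝ) :=
  (netsOn K σ n).topologicalClosure

/-- Convolution with the kernel `w`, applied to the values of a function on `K`. -/
noncomputable def convOn (w : ℤ → ℝ) : C(K, Fin d → ℝ) →L[ℝ] C(K, Fin d → ℝ) :=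
  (convCLM w).compLeftContinuous ℝ K

variable {K}

theorem isClosed_netsClosure (σ : ℝ → ℝ) (n : ℕ) :
    IsClosed (netsClosure K σ n : Set C(K, Fin d → ℝ)) :=
  Submodule.isClosed_topologicalClosure _

theorem netsOn_le_netsClosure (σ : ℝ → ℝ) (n : ℕ) : netsOn K σ n ≤ netsClosure K σ n :=
  Submodule.le_topologicalClosure _

theorem convOn_apply (w : ℤ → ℝ) (F : C(K, Fin d → ℝ)) (x : K) :
    convOn K w F x = zeroPadConv 1 w (F x) := rfl

theorem one_mem_netsClosure (σ : ℝ → ℝ) (n : ℕ) : 1 ∈ netsClosure K σ n :=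
  netsOn_le_netsClosure σ n (mem_netsOn.2 ⟨1, one_mem_channelNets σ n, fun _ => rfl⟩)

/-- A further layer produces, up to uniform approximation, the convolutions of all powers of the
functions obtained so far, whatever the activation function. -/
theorem convOn_pow_mem (σ : C(ℝ, ℝ)) (hσ : ¬ ∃ p : Polynomial ℝ, ∀ t : ℝ, σ t = p.eval t)
    (n : ℕ) (w : ℤ → ℝ) (k : ℕ) (u : C(K, Fin d → ℝ)) (hu : u ∈ netsClosure K σ n) :
    convOn K w (u ^ k) ∈ netsClosure K σ (n + 1) := by
  have hcl : IsClosed {u : C(K, Fin d → ℝ) | convOn K w (u ^ k) ∈ netsClosure K σ (n + 1)} :=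
    (isClosed_netsClosure σ (n + 1)).preimage ((convOn K w).continuous.comp (continuous_pow k))
  refine closure_minimal (s := (netsOn K σ n : Set C(K, Fin d → ℝ))) (fun u hu => ?_) hcl hu
  obtain ⟨f, hf, hfu⟩ := mem_netsOn.1 hu
  refine pow_mem_of_pointwise_mem ((netsClosure K σ (n + 1)).comap (convOn K w).toLinearMap)
    ((isClosed_netsClosure σ (n + 1)).preimage (convOn K w).continuous) u σ hσ (fun a b => ?_) k
  refine netsOn_le_netsClosure _ _ (mem_netsOn.2 ⟨_, conv_mem_channelNets_succ σ w
    (add_mem (Submodule.smul_mem _ a hf) (Submodule.smul_mem _ b (one_mem_channelNets σ n))), ?_⟩)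
  intro x
  change (fun t => zeroPadConv 1 w (fun s => σ (a * f x s + b * 1)) t) = _
  rw [hfu]
  rfl

theorem convOn_mem_of_mem_adjoin (σ : C(ℝ, ℝ))
    (hσ : ¬ ∃ p : Polynomial ℝ, ∀ t : ℝ, σ t = p.eval t) (n : ℕ) (w : ℤ → ℝ)
    (F : C(K, Fin d → ℝ))
    (hF : F ∈ Algebra.adjoin ℝ (netsClosure K σ n : Set C(K, Fin d → ℝ))) :
    convOn K w F ∈ netsClosure K σ (n + 1) :=
  adjoin_le_of_pow_mem (netsClosure K σ n)
    ((netsClosure K σ (n + 1)).comap (convOn K w).toLinearMap)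
    ((isClosed_netsClosure σ (n + 1)).preimage (convOn K w).continuous)
    (fun u hu k => convOn_pow_mem σ hσ n w k u hu) hF

theorem universalOn_of_netsClosure_eq_top (σ : ℝ → ℝ) (n c' : ℕ)
    (h : netsClosure K σ n = ⊤) : UniversalOn σ K (n + 1) c' := by
  let Φ : (Fin c' → C(K, Fin d → ℝ)) → C(K, Signal c' d) := fun F =>
    ⟨fun x => WithLp.toLp 2 fun p => F p.1 x p.2, by fun_prop⟩
  have hΦ : Continuous Φ := by
    refine ContinuousMap.continuous_of_continuous_uncurry _ ?_
    refine (PiLp.continuous_toLp 2 _).comp (continuous_pi fun p => ?_)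
    change Continuous fun q : (Fin c' → C(K, Fin d → ℝ)) × K => q.1 p.1 q.2 p.2
    fun_prop
  have hdense : Dense (Set.univ.pi fun _ : Fin c' => (netsOn K σ n : Set C(K, Fin d → ℝ))) := by
    refine dense_pi _ fun i _ => ?_
    rw [dense_iff_closure_eq]
    exact congrArg (fun M : Submodule ℝ C(K, Fin d → ℝ) => (M : Set C(K, Fin d → ℝ))) h
  rw [UniversalOn, Set.eq_univ_iff_forall]
  intro g
  let F : Fin c' → C(K, Fin d → ℝ) := fun i => ⟨fun x t => g x (i, t), by fun_prop⟩
  have hF : Φ F = g := by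
    ext x p
    rfl
  rw [← hF]
  refine closure_mono ?_ (image_closure_subset_closure_image hΦ ⟨F, hdense F, rfl⟩)
  rintro _ ⟨G, hG, rfl⟩
  choose f hf hfG using fun i => mem_netsOn.1 (hG i (Set.mem_univ i))
  refine ⟨_, stack_mem_networks σ n c' f hf, fun x => ?_⟩
  change WithLp.toLp 2 _ = WithLp.toLp 2 _
  simp only [hfG]

end Closure

/-! ### Entries, windows and positions -/

section Positions

variable {c d : ℕ} {K : TopologicalSpace.Compacts (Signal c d)}

variable (K) in
/-- The function whose value at position `t` is the entry of channel `j` at position `t + m`, with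
zero padding. -/
noncomputable def window (m : ℤ) (j : Fin c) : C(K, Fin d → ℝ) :=
  ⟨fun x t => zeroPad (fun s => (x : Signal c d) (j, s)) (t + 1 + m), by
    refine continuous_pi fun t => ?_
    unfold zeroPad
    split_ifs <;> fun_prop⟩

variable (K) in
/-- The constant function equal to the indicator of position `i`. -/
noncomputable def position (i : Fin d) : C(K, Fin d → ℝ) :=
  ContinuousMap.const K (Pi.single i 1)

/-- The entry of a function at position `i`. -/
noncomputable def entry (i : Fin d) : C(K, Fin d → ℝ) →ₐ[ℝ] C(K, ℝ) :=
  (Pi.evalAlgHom ℝ (fun _ : Fin d => ℝ) i).compLeftContinuous ℝ (continuous_apply i)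

/-- The function with entry `f` at position `i` and zeros elsewhere. -/
noncomputable def place (i : Fin d) : C(K, ℝ) →L[ℝ] C(K, Fin d → ℝ) :=
  (ContinuousLinearMap.single ℝ (fun _ : Fin d => ℝ) i).compLeftContinuous ℝ K

variable (K) in
/-- The coordinate function of channel `j` and position `k`. -/
noncomputable def coordinate (j : Fin c) (k : Fin d) : C(K, ℝ) :=
  ⟨fun x => (x : Signal c d) (j, k), by fun_prop⟩

variable (K) in
/-- The shift by `m ∈ {-1, 0, 1}` positions, with zero padding. -/
noncomputable def shift (m : ℤ) : C(K, Fin d → ℝ) →L[ℝ] C(K, Fin d → ℝ) :=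
  convOn K (Pi.single m 1)

theorem window_apply (m : ℤ) (j : Fin c) (x : K) (t : Fin d) :
    window K m j x t = zeroPad (fun s => (x : Signal c d) (j, s)) (t + 1 + m) := rfl

theorem position_apply (i : Fin d) (x : K) (t : Fin d) :
    position K i x t = if t = i then 1 else 0 := by
  simp [position, Pi.single_apply]

theorem entry_apply (i : Fin d) (F : C(K, Fin d → ℝ)) (x : K) : entry i F x = F x i := rfl

theorem place_apply (i : Fin d) (f : C(K, ℝ)) (x : K) (t : Fin d) :
    place i f x t = if t = i then f x else 0 := by
  change (Pi.single i (f x) : Fin d → ℝ) t = _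
  rw [Pi.single_apply]

theorem shift_apply {m : ℤ} (hm : |m| ≤ 1) (F : C(K, Fin d → ℝ)) (x : K) (t : Fin d) :
    shift K m F x t = zeroPad (F x) (t + 1 + m) := by
  rw [shift, convOn_apply, zeroPadConv_single m hm]

theorem shift_zero (F : C(K, Fin d → ℝ)) : shift K 0 F = F := by
  ext x : 1
  rw [shift, convOn_apply, zeroPadConv_single_zero]

theorem entry_window {m : ℤ} {j : Fin c} {i k : Fin d} (h : (k : ℤ) = i + m) :
    entry i (window K m j) = coordinate K j k := by
  ext x
  rw [entry_apply, window_apply, zeroPad_of_mem _ _ k (by omega)]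
  rfl

theorem entry_window_eq {m m' : ℤ} {j : Fin c} {i i' : Fin d} (h : (i : ℤ) + m = i' + m') :
    entry i (window K m j) = entry i' (window K m' j) := by
  ext x
  simp only [entry_apply, window_apply]
  congr 1
  omega

/-- By the Stone–Weierstrass theorem, a closed subspace of `C(K, ℝ)` containing the image of a
subalgebra `R` in which all coordinate functions occur is everything. Here this is applied to the
functions which, placed at position `i`, belong to the closed subspace `W`. -/
theorem place_mem_of_coordinate (W : Submodule ℝ C(K, Fin d → ℝ))
    (hW : IsClosed (W : Set C(K, Fin d → ℝ))) (i i' : Fin d) (R : Subalgebra ℝ C(K, Fin d → ℝ))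
    (hR : ∀ F ∈ R, place i (entry i' F) ∈ W)
    (hcoord : ∀ j k, ∃ F ∈ R, entry i' F = coordinate K j k) (f : C(K, ℝ)) :
    place i f ∈ W := by
  have hsep : (R.map (entry i')).SeparatesPoints := by
    intro x y hxy
    have : ∃ p, (x : Signal c d) p ≠ (y : Signal c d) p := by
      by_contra! h
      exact hxy (Subtype.ext (PiLp.ext h))
    obtain ⟨⟨j, k⟩, hp⟩ := this
    obtain ⟨F, hF, hFe⟩ := hcoord j k
    exact ⟨coordinate K j k, ⟨coordinate K j k, ⟨F, hF, hFe⟩, rfl⟩, hp⟩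
  have htop := ContinuousMap.subalgebra_topologicalClosure_eq_top_of_separatesPoints _ hsep
  have hf : f ∈ (R.map (entry i')).topologicalClosure := htop ▸ Algebra.mem_top
  refine closure_minimal (t := place i ⁻¹' (W : Set C(K, Fin d → ℝ))) ?_
    (hW.preimage (place i).continuous) hf
  rintro _ ⟨F, hF, rfl⟩
  exact hR F hF

theorem eq_top_of_place_mem (W : Submodule ℝ C(K, Fin d → ℝ))
    (h : ∀ i f, place i f ∈ W) : W = ⊤ := by
  rw [Submodule.eq_top_iff']
  intro F
  have : F = ∑ i, place i (entry i F) := by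
    ext x t
    simp [ContinuousMap.sum_apply, place_apply, entry_apply]
  rw [this]
  exact W.sum_mem fun i _ => h i _

end Positions

/-! ### What a given depth can express -/

section Depth

variable {c d : ℕ} {K : TopologicalSpace.Compacts (Signal c d)} {σ : C(ℝ, ℝ)}
  (hσ : ¬ ∃ p : Polynomial ℝ, ∀ t : ℝ, σ t = p.eval t)

variable (K) in
/-- The algebra generated by the limits of networks with `n + 1` layers. -/
noncomputable def netsAlgebra (σ : ℝ → ℝ) (n : ℕ) : Subalgebra ℝ C(K, Fin d → ℝ) :=
  Algebra.adjoin ℝ (netsClosure K σ n : Set C(K, Fin d → ℝ))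

theorem mem_netsAlgebra {n : ℕ} {F : C(K, Fin d → ℝ)} (h : F ∈ netsClosure K σ n) :
    F ∈ netsAlgebra K σ n :=
  Algebra.subset_adjoin h

include hσ

theorem shift_mem {n : ℕ} (m : ℤ) {F : C(K, Fin d → ℝ)} (hF : F ∈ netsAlgebra K σ n) :
    shift K m F ∈ netsClosure K σ (n + 1) :=
  convOn_mem_of_mem_adjoin σ hσ n _ F hF

theorem mem_netsClosure_succ {n : ℕ} {F : C(K, Fin d → ℝ)} (hF : F ∈ netsAlgebra K σ n) :
    F ∈ netsClosure K σ (n + 1) := by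
  simpa only [shift_zero] using shift_mem hσ 0 hF

theorem window_mem (n : ℕ) (m : ℤ) (hm : |m| ≤ n + 1) (j : Fin c) :
    window K m j ∈ netsClosure K σ n := by
  induction n generalizing m with
  | zero =>
    refine netsOn_le_netsClosure _ _
      (mem_netsOn.2 ⟨_, conv_mem_channelNets_zero σ (Pi.single m 1) j, fun x => ?_⟩)
    funext t
    exact zeroPadConv_single m (by simpa using hm) _ t
  | succ n ih =>
    push_cast at hm
    by_cases h : |m| ≤ n + 1
    · exact mem_netsClosure_succ hσ (mem_netsAlgebra (ih m h))
    -- shifting the extreme windows outwards loses nothing, the padded entries being zero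
    have key : ∀ e : ℤ, |e| = 1 → |m - e| ≤ n + 1 → 0 ≤ e * (m - e) →
        window K m j ∈ netsClosure K σ (n + 1) := by
      intro e he hme hs
      have h1 := shift_mem hσ e (mem_netsAlgebra (ih (m - e) hme))
      convert h1 using 1
      ext x t
      rw [shift_apply he.le, window_apply]
      have ht := t.2
      by_cases hin : 1 ≤ (t : ℤ) + 1 + e ∧ (t : ℤ) + 1 + e ≤ d
      · rw [zeroPad_of_mem _ ((t : ℤ) + 1 + e) ⟨((t : ℤ) + e).toNat, by omega⟩
          (by simp only []; omega), window_apply]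
        congr 1
        simp only []
        omega
      · rw [zeroPad_of_notMem _ ((t : ℤ) + 1 + e) (by omega), zeroPad_of_notMem]
        obtain rfl | rfl := (abs_eq (by norm_num)).1 he <;> omega
    rcases le_or_gt 0 m with h0 | h0
    · rw [abs_of_nonneg h0] at hm h
      exact key 1 (by norm_num) (by rw [abs_le]; omega) (by omega)
    · rw [abs_of_neg h0] at hm h
      exact key (-1) (by norm_num) (by rw [abs_le]; omega) (by omega)

/-- Zero padding makes positions close to the boundary recognizable: each layer finds one more
position on either side. -/
theorem position_mem (n : ℕ) (i : Fin d) (hi : (i : ℕ) < n ∨ d ≤ i + n) :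
    position K i ∈ netsClosure K σ n := by
  induction n generalizing i with
  | zero => omega
  | succ n ih =>
    have hone : (1 : C(K, Fin d → ℝ)) ∈ netsAlgebra K σ n := one_mem _
    have hone' : (1 : C(K, Fin d → ℝ)) ∈ netsClosure K σ (n + 1) := one_mem_netsClosure _ _
    have hid := i.2
    -- a boundary position is found by shifting the constant `1` out over that boundary, and its
    -- indicator then moves inwards by one position per layer
    have key : ∀ e : ℤ, |e| = 1 →
        (((i : ℤ) + e < 0 ∨ (d : ℤ) ≤ i + e) ∨
          ∃ i' : Fin d, (i' : ℤ) = i + e ∧ ((i' : ℕ) < n ∨ d ≤ i' + n)) →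
        position K i ∈ netsClosure K σ (n + 1) := by
      intro e he h
      rcases h with h | ⟨i', hi', hn⟩
      · convert sub_mem hone' (shift_mem hσ e hone) using 1
        ext x t
        rw [position_apply, ContinuousMap.sub_apply, Pi.sub_apply, shift_apply he.le]
        have ht := t.2
        by_cases hti : t = i
        · subst hti
          rw [zeroPad_of_notMem _ _ (by omega)]
          simp
        · have hti' : (t : ℕ) ≠ i := fun h => hti (Fin.ext h)
          rw [zeroPad_of_mem _ ((t : ℤ) + 1 + e) ⟨((t : ℤ) + e).toNat, by
            obtain rfl | rfl := (abs_eq (by norm_num)).1 he <;> omega⟩ (by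
            simp only []
            obtain rfl | rfl := (abs_eq (by norm_num)).1 he <;> omega)]
          simp [hti]
      · convert shift_mem hσ e (mem_netsAlgebra (ih i' hn)) using 1
        ext x t
        rw [position_apply, shift_apply he.le]
        have ht := t.2
        by_cases hin : 1 ≤ (t : ℤ) + 1 + e ∧ (t : ℤ) + 1 + e ≤ d
        · rw [zeroPad_of_mem _ ((t : ℤ) + 1 + e) ⟨((t : ℤ) + e).toNat, by omega⟩
            (by simp only []; omega), position_apply]
          congr 1
          simp only [Fin.ext_iff, eq_iff_iff]
          omega
        · rw [zeroPad_of_notMem _ ((t : ℤ) + 1 + e) (by omega), if_neg]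
          rintro rfl
          have := i'.2
          omega
    rcases hi with hi | hi
    · refine key (-1) (by norm_num) ?_
      by_cases h0 : (i : ℕ) = 0
      · exact Or.inl (by omega)
      · exact Or.inr ⟨⟨i - 1, by omega⟩, by simp only []; omega, Or.inl (by simp only []; omega)⟩
    · refine key 1 (by norm_num) ?_
      by_cases h0 : (i : ℕ) + 1 = d
      · exact Or.inl (by omega)
      · exact Or.inr ⟨⟨i + 1, by omega⟩, by simp, Or.inr (by simp only []; omega)⟩

/-- If position `i'` sees all entries and can be recognized, then one more layer can put an
arbitrary function at any neighbouring position `i`. -/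
theorem place_mem_of_position_mem {n : ℕ} {i i' : Fin d} (hi : |(i' : ℤ) - i| ≤ 1)
    (hpos : position K i' ∈ netsAlgebra K σ n) (hl : (i' : ℕ) ≤ n + 1) (hr : d ≤ i' + n + 2)
    (f : C(K, ℝ)) : place i f ∈ netsClosure K σ (n + 1) := by
  refine place_mem_of_coordinate _ (isClosed_netsClosure _ _) i i' (netsAlgebra K σ n) ?_ ?_ f
  · intro F hF
    convert shift_mem hσ ((i' : ℤ) - i) (mul_mem hF hpos) using 1
    ext x t
    rw [shift_apply hi, place_apply]
    have ht := t.2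
    by_cases hti : t = i
    · subst hti
      rw [zeroPad_of_mem _ _ i' (by omega)]
      simp [position_apply, entry_apply]
    · have hti' : (t : ℕ) ≠ i := fun h => hti (Fin.ext h)
      rw [if_neg hti]
      by_cases hin : 1 ≤ (t : ℤ) + 1 + (i' - i) ∧ (t : ℤ) + 1 + (i' - i) ≤ d
      · rw [zeroPad_of_mem _ _ ⟨((t : ℤ) + (i' - i)).toNat, by omega⟩ (by simp only []; omega),
          ContinuousMap.mul_apply, Pi.mul_apply, position_apply, if_neg, mul_zero]
        simp only [Fin.ext_iff]
        omega
      · rw [zeroPad_of_notMem _ _ (by omega)]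
  · intro j k
    have := k.2
    exact ⟨_, mem_netsAlgebra (window_mem hσ n ((k : ℤ) - i') (by rw [abs_le]; omega) j),
      entry_window (by omega)⟩

theorem netsClosure_eq_top_one (K : TopologicalSpace.Compacts (Signal c 1)) :
    netsClosure K σ 1 = ⊤ := by
  refine eq_top_of_place_mem _ fun i f => ?_
  refine place_mem_of_position_mem hσ (n := 0) (i' := i) (by simp) ?_ (by omega) (by omega) f
  convert one_mem (netsAlgebra K σ 0)
  ext x t
  simp [position_apply, Subsingleton.elim t i]

/-- In dimension two, a shift leaves a single entry, which depends on all inputs. -/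
theorem netsClosure_eq_top_two (K : TopologicalSpace.Compacts (Signal c 2)) :
    netsClosure K σ 1 = ⊤ := by
  have key : ∀ i i' : Fin 2, i' ≠ i → ∀ f, place i f ∈ netsClosure K σ 1 := by
    intro i i' hi f
    refine place_mem_of_coordinate _ (isClosed_netsClosure _ _) i i' (netsAlgebra K σ 0) ?_ ?_ f
    · intro F hF
      convert shift_mem hσ ((i' : ℤ) - i) hF using 1
      ext x t
      rw [shift_apply (by fin_cases i <;> fin_cases i' <;> simp), place_apply]
      by_cases hti : t = i
      · subst hti
        rw [zeroPad_of_mem _ _ i' (by omega), if_pos rfl, entry_apply]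
      · rw [if_neg hti, zeroPad_of_notMem]
        omega
    · intro j k
      exact ⟨_, mem_netsAlgebra (window_mem hσ 0 ((k : ℤ) - i') (by rw [abs_le]; omega) j),
        entry_window (by omega)⟩
  refine eq_top_of_place_mem _ fun i f => key i (1 - i) ?_ f
  fin_cases i <;> decide

theorem netsClosure_eq_top_of_position_mem (n : ℕ) (hd : 3 ≤ d) (hdn : d ≤ n + 3)
    (hpos : ∀ i, position K i ∈ netsAlgebra K σ n) : netsClosure K σ (n + 1) = ⊤ := by
  refine eq_top_of_place_mem _ fun i f => ?_
  have hi := i.2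
  by_cases h0 : (i : ℕ) = 0
  · exact place_mem_of_position_mem hσ (i' := ⟨1, by omega⟩) (by rw [abs_le]; simp only []; omega)
      (hpos _) (by simp) (by simp only []; omega) f
  by_cases h1 : (i : ℕ) + 1 = d
  · exact place_mem_of_position_mem hσ (i' := ⟨d - 2, by omega⟩)
      (by rw [abs_le]; simp only []; omega)
      (hpos _) (by simp only []; omega) (by simp only []; omega) f
  · exact place_mem_of_position_mem hσ (i' := i) (by simp) (hpos _) (by omega) (by omega) f

theorem netsClosure_eq_top_of_ne_four (n : ℕ) (hd : 3 ≤ d) (hdn : d ≤ n + 3)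
    (hd2 : d ≤ 2 * n + 1) : netsClosure K σ (n + 1) = ⊤ := by
  refine netsClosure_eq_top_of_position_mem hσ n hd hdn fun i => ?_
  by_cases hi : (i : ℕ) < n ∨ d ≤ i + n
  · exact mem_netsAlgebra (position_mem hσ n i hi)
  -- the only position not found from either side is the middle one
  have hpos : position K i = 1 - ∑ k ∈ Finset.univ.erase i, position K k := by
    ext x t
    simp only [position_apply, ContinuousMap.sub_apply, ContinuousMap.one_apply, Pi.sub_apply,
      Pi.one_apply, ContinuousMap.sum_apply, Finset.sum_apply]
    by_cases hti : t = i <;> simp [hti]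
  rw [hpos]
  refine sub_mem (one_mem _) (sum_mem fun k hk => mem_netsAlgebra (position_mem hσ n k ?_))
  have : (k : ℕ) ≠ i := fun h => (Finset.mem_erase.1 hk).1 (Fin.ext h)
  omega

end Depth

/-! ### Dimension four -/

section FourPositions

variable {c : ℕ} {σ : C(ℝ, ℝ)} (hσ : ¬ ∃ p : Polynomial ℝ, ∀ t : ℝ, σ t = p.eval t)

include hσ

/-- In dimension four, two layers recognize only the boundary positions, and only the functions
`(0, F₂, F₃, 0)` with two inner entries are directly available. One of these entries
can be cancelled by the shift of a function `(0, 0, 0, F₄)` or `(F₁, 0, 0, 0)`, since the windows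
seen from the boundary position give the cancelled entry the required form. -/
theorem netsClosure_eq_top_four (K : TopologicalSpace.Compacts (Signal c 4)) :
    netsClosure K σ 2 = ⊤ := by
  have hp0 : position K (0 : Fin 4) ∈ netsAlgebra K σ 1 :=
    mem_netsAlgebra (position_mem hσ 1 0 (by simp))
  have hp3 : position K (3 : Fin 4) ∈ netsAlgebra K σ 1 :=
    mem_netsAlgebra (position_mem hσ 1 3 (by simp))
  have hin : (1 - position K (0 : Fin 4) - position K 3) ∈ netsAlgebra K σ 1 :=
    sub_mem (sub_mem (one_mem _) hp0) hp3
  have hwin : ∀ m : ℤ, |m| ≤ 2 → ∀ j, window K m j ∈ netsAlgebra K σ 1 := fun m hm j =>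
    mem_netsAlgebra (window_mem hσ 1 m (by simpa using hm) j)
  -- `i` is an inner position, `i'` the other one, `b` the boundary position next to `i'`
  have inner : ∀ i i' b : Fin 4, ((i : ℕ) = 1 ∧ (i' : ℕ) = 2 ∧ (b : ℕ) = 3) ∨
      ((i : ℕ) = 2 ∧ (i' : ℕ) = 1 ∧ (b : ℕ) = 0) →
      ∀ f, place i f ∈ netsClosure K σ 2 := by
    intro i i' b hib f
    have hpb : position K b ∈ netsAlgebra K σ 1 := by
      obtain rfl | rfl : b = 0 ∨ b = 3 := by omega
      · exact hp0
      · exact hp3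
    let R : Subalgebra ℝ C(K, Fin 4 → ℝ) :=
      netsAlgebra K σ 1 ⊓ ((netsAlgebra K σ 1).map (entry b)).comap (entry i')
    refine place_mem_of_coordinate _ (isClosed_netsClosure _ _) i i R ?_ ?_ f
    · rintro G ⟨hG, F, hF, hFG⟩
      have hFG' : ∀ x, F x b = G x i' := fun x => DFunLike.congr_fun hFG x
      have h1 := mem_netsClosure_succ hσ (mul_mem hG hin)
      have h2 := shift_mem hσ ((b : ℤ) - i') (mul_mem hF hpb)
      convert sub_mem h1 h2 using 1
      ext x t
      rw [ContinuousMap.sub_apply, Pi.sub_apply, shift_apply (by rw [abs_le]; omega), place_apply]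
      simp only [ContinuousMap.mul_apply, ContinuousMap.sub_apply, ContinuousMap.one_apply,
        Pi.mul_apply, Pi.sub_apply, Pi.one_apply, position_apply, entry_apply]
      by_cases hti' : t = i'
      · subst hti'
        rw [zeroPad_of_mem _ _ b (by omega), if_neg (by omega), if_neg (by omega),
          if_neg (by omega)]
        simp [position_apply, hFG']
      · have hz : zeroPad (F x * position K b x) ((t : ℤ) + 1 + (b - i')) = 0 := by
          by_cases hr : 1 ≤ (t : ℤ) + 1 + (b - i') ∧ (t : ℤ) + 1 + (b - i') ≤ 4
          · rw [zeroPad_of_mem _ _ ⟨((t : ℤ) + (b - i')).toNat, by omega⟩ (by simp only []; omega),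
              Pi.mul_apply, position_apply, if_neg, mul_zero]
            simp only [Fin.ext_iff]
            omega
          · exact zeroPad_of_notMem _ _ (by push_cast; omega)
        rw [hz, sub_zero]
        by_cases hti : t = i
        · subst hti
          rw [if_pos rfl, if_neg (by omega), if_neg (by omega)]
          ring
        · rw [if_neg hti]
          obtain rfl | rfl : t = 0 ∨ t = 3 := by omega
          · simp
          · simp
    · intro j k
      refine ⟨window K ((k : ℤ) - i) j, ⟨hwin _ (by rw [abs_le]; omega) j, ?_⟩,
        entry_window (by omega)⟩
      exact ⟨window K ((k : ℤ) - i + i' - b) j, hwin _ (by rw [abs_le]; omega) j,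
        entry_window_eq (by omega)⟩
  have outer : ∀ i i' b : Fin 4, ((i : ℕ) = 1 ∧ (i' : ℕ) = 2 ∧ (b : ℕ) = 0) ∨
      ((i : ℕ) = 2 ∧ (i' : ℕ) = 1 ∧ (b : ℕ) = 3) →
      ∀ f, place b f ∈ netsClosure K σ 2 := by
    intro i i' b hib f
    refine place_mem_of_coordinate _ (isClosed_netsClosure _ _) b i (netsAlgebra K σ 1) ?_ ?_ f
    · intro G hG
      have h1 := shift_mem hσ ((i : ℤ) - b) (mul_mem hG hin)
      have h2 := inner i i' (3 - b) (by omega) (entry i' G)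
      convert sub_mem h1 h2 using 1
      ext x t
      rw [ContinuousMap.sub_apply, Pi.sub_apply, shift_apply (by rw [abs_le]; omega), place_apply,
        place_apply]
      by_cases hr : 1 ≤ (t : ℤ) + 1 + (i - b) ∧ (t : ℤ) + 1 + (i - b) ≤ 4
      · obtain ⟨s, hs⟩ : ∃ s : Fin 4, (s : ℤ) = t + (i - b) :=
          ⟨⟨((t : ℤ) + (i - b)).toNat, by omega⟩, by simp only []; omega⟩
        rw [zeroPad_of_mem _ _ s (by omega)]
        simp only [ContinuousMap.mul_apply, ContinuousMap.sub_apply, ContinuousMap.one_apply,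
          Pi.mul_apply, Pi.sub_apply, Pi.one_apply, position_apply, entry_apply]
        by_cases htb : t = b
        · obtain rfl : s = i := by omega
          rw [if_pos htb, if_neg (by omega), if_neg (by omega), if_neg (by omega)]
          ring
        · by_cases hti : t = i
          · obtain rfl : s = i' := by omega
            rw [if_neg htb, if_pos hti, if_neg (by omega), if_neg (by omega)]
            ring
          · rw [if_neg htb, if_neg hti]
            obtain rfl | rfl : s = 0 ∨ s = 3 := by omega
            · simp
            · simp
      · rw [zeroPad_of_notMem _ _ (by push_cast; omega), if_neg (by omega), if_neg (by omega),
          sub_zero]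
    · intro j k
      exact ⟨_, hwin ((k : ℤ) - i) (by rw [abs_le]; omega) j, entry_window (by omega)⟩
  refine eq_top_of_place_mem _ fun i f => ?_
  fin_cases i
  · exact outer 1 2 0 (by simp) f
  · exact inner 1 2 3 (by simp) f
  · exact inner 2 1 0 (by simp) f
  · exact outer 2 1 3 (by simp) f

/-- The upper bound for the depth. -/
theorem universalOn_minDepth {d : ℕ} (hd : 1 ≤ d) (K : TopologicalSpace.Compacts (Signal c d))
    (c' : ℕ) : UniversalOn σ K (minDepth d) c' := by
  obtain rfl | rfl | rfl | rfl | h5 : d = 1 ∨ d = 2 ∨ d = 3 ∨ d = 4 ∨ 5 ≤ d := by omega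
  · exact universalOn_of_netsClosure_eq_top σ 1 c' (netsClosure_eq_top_one hσ K)
  · exact universalOn_of_netsClosure_eq_top σ 1 c' (netsClosure_eq_top_two hσ K)
  · exact universalOn_of_netsClosure_eq_top σ 2 c'
      (netsClosure_eq_top_of_ne_four hσ 1 le_rfl (by norm_num) (by norm_num))
  · exact universalOn_of_netsClosure_eq_top σ 2 c' (netsClosure_eq_top_four hσ K)
  · have : minDepth d = (d - 3 + 1) + 1 := by
      rw [minDepth, if_neg (by omega), if_neg (by omega)]
      omega
    rw [this]
    exact universalOn_of_netsClosure_eq_top σ _ c'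
      (netsClosure_eq_top_of_ne_four hσ (d - 3) (by omega) (by omega) (by omega))

end FourPositions

/-! ### Lower bounds for the depth -/

section LowerBound

variable {c c' d : ℕ}

theorem not_universalOn_of_functional {σ : ℝ → ℝ} {K : TopologicalSpace.Compacts (Signal c d)}
    {N : ℕ} (Λ : C(K, Signal c' d) → ℝ) (hΛ : Continuous Λ)
    (h : ∀ g ∈ networksOn σ 1 K N c', Λ g = 0) (g : C(K, Signal c' d)) (hg : Λ g ≠ 0) :
    ¬ UniversalOn σ K N c' := by
  intro hu
  have hcl : closure (networksOn σ 1 K N c') ⊆ {g | Λ g = 0} :=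
    closure_minimal h (isClosed_eq hΛ continuous_const)
  rw [UniversalOn] at hu
  exact hg (hcl (hu ▸ Set.mem_univ g))

theorem exists_pos_add_single_mem {K : Set (Signal c d)} {x : Signal c d} (hx : x ∈ interior K) :
    ∃ ε : ℝ, 0 < ε ∧
      ∀ p, x + EuclideanSpace.single p ε ∈ K ∧ x - EuclideanSpace.single p ε ∈ K := by
  obtain ⟨r, hr, hrK⟩ := Metric.isOpen_iff.1 isOpen_interior x hx
  refine ⟨r / 2, by positivity, fun p => ⟨interior_subset (hrK ?_), interior_subset (hrK ?_)⟩⟩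
  · simp [abs_of_pos hr, hr]
  · simp [abs_of_pos hr, hr]

theorem zeroPad_congr {y z : Fin d → ℝ} {i : ℤ} (h : ∀ s : Fin d, (s : ℤ) + 1 = i → y s = z s) :
    zeroPad y i = zeroPad z i := by
  unfold zeroPad
  split_ifs with hi
  · exact h _ (by simp only []; omega)
  · rfl

theorem convLayer_apply (k : ℕ) (W : Fin c' → Fin c → ℤ → ℝ) (δ : Fin c' → ℝ) (x : Signal c d)
    (i : Fin c') (t : Fin d) : convLayer k W δ x (i, t) =
      ∑ j, zeroPadConv k (W i j) (fun s => x (j, s)) t + δ i := rfl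

/-- With `N` layers, an output entry depends only on the inputs up to `N` positions further. -/
theorem networks_apply_eq_of_eq {σ : ℝ → ℝ} {N : ℕ} {f : Signal c d → Signal c' d}
    (hf : f ∈ networks σ 1 c d N c') {x y : Signal c d} {r : ℕ}
    (hxy : ∀ j, ∀ t : Fin d, (t : ℕ) < r → x (j, t) = y (j, t)) (i : Fin c') (t : Fin d)
    (ht : (t : ℕ) + N < r) : f x (i, t) = f y (i, t) := by
  have layer : ∀ {m m' : ℕ} (W : Fin m' → Fin m → ℤ → ℝ) (δ : Fin m' → ℝ) (x y : Signal m d)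
      (i : Fin m') (t : Fin d), (∀ j, ∀ s : Fin d, (s : ℕ) ≤ t + 1 → x (j, s) = y (j, s)) →
      convLayer 1 W δ x (i, t) = convLayer 1 W δ y (i, t) := by
    intro m m' W δ x y i t h
    rw [convLayer_apply, convLayer_apply]
    congr 1
    refine Finset.sum_congr rfl fun j _ => ?_
    rw [zeroPadConv_one_apply, zeroPadConv_one_apply]
    congr 1
    · congr 1
      all_goals
        congr 1
        exact zeroPad_congr fun s hs => h j s (by omega)
    · congr 1
      exact zeroPad_congr fun s hs => h j s (by omega)
  induction N using Nat.twoStepInduction generalizing c' t with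
  | zero => exact absurd hf (Set.notMem_empty f)
  | one =>
    obtain ⟨W, δ, rfl⟩ := hf
    exact layer W δ x y i t fun j s hs => hxy j s (by omega)
  | more n _ ih =>
    obtain ⟨m, g, C, hg, ⟨W, δ, rfl⟩, rfl⟩ := hf
    refine layer W δ _ _ i t fun j s hs => ?_
    change σ (g x (j, s)) = σ (g y (j, s))
    rw [ih hg j s (by omega)]

theorem not_universalOn_zero (σ : ℝ → ℝ) (K : TopologicalSpace.Compacts (Signal c d)) :
    ¬ UniversalOn σ K 0 c' := by
  have : networksOn σ 1 K 0 c' = ∅ :=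
    Set.eq_empty_of_forall_notMem fun g ⟨f, hf, _⟩ => Set.notMem_empty f hf
  rw [UniversalOn, this, closure_empty]
  exact Set.empty_ne_univ

/-- Networks with a single layer are affine, so their second differences vanish. -/
theorem not_universalOn_one (σ : ℝ → ℝ) (K : TopologicalSpace.Compacts (Signal c d))
    (hK : (interior (K : Set (Signal c d))).Nonempty) (hc : 1 ≤ c) (hc' : 1 ≤ c') (hd : 1 ≤ d) :
    ¬ UniversalOn σ K 1 c' := by
  obtain ⟨x, hx⟩ := hK
  obtain ⟨ε, hε, hεK⟩ := exists_pos_add_single_mem hx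
  let p : Fin c × Fin d := (⟨0, hc⟩, ⟨0, hd⟩)
  let q : Fin c' × Fin d := (⟨0, hc'⟩, ⟨0, hd⟩)
  let x₀ : K := ⟨x, interior_subset hx⟩
  let x₁ : K := ⟨_, (hεK p).1⟩
  let x₂ : K := ⟨_, (hεK p).2⟩
  refine not_universalOn_of_functional (fun g => g x₁ q + g x₂ q - 2 * g x₀ q) (by fun_prop) ?_
    ⟨fun y => WithLp.toLp 2 fun _ => ((y : Signal c d) p - x p) ^ 2, by fun_prop⟩ ?_
  · rintro g ⟨_, ⟨W, δ, rfl⟩, hg⟩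
    simp only [hg, q, convLayer_apply]
    have key : ∀ j, zeroPadConv 1 (W ⟨0, hc'⟩ j) (fun s => (x₁ : Signal c d) (j, s)) ⟨0, hd⟩ +
        zeroPadConv 1 (W ⟨0, hc'⟩ j) (fun s => (x₂ : Signal c d) (j, s)) ⟨0, hd⟩ =
        2 * zeroPadConv 1 (W ⟨0, hc'⟩ j) (fun s => (x₀ : Signal c d) (j, s)) ⟨0, hd⟩ := by
      intro j
      have h : (fun s => (x₁ : Signal c d) (j, s)) + (fun s => (x₂ : Signal c d) (j, s)) =
          (2 : ℝ) • fun s => (x₀ : Signal c d) (j, s) := by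
        funext s
        simp only [x₀, x₁, x₂, Pi.add_apply, PiLp.add_apply, PiLp.sub_apply, Pi.smul_apply,
          smul_eq_mul]
        ring
      have h2 := congrArg (fun y => convCLM (W ⟨0, hc'⟩ j) y ⟨0, hd⟩) h
      simpa only [map_add, map_smul, Pi.add_apply, Pi.smul_apply, smul_eq_mul,
        convCLM_apply] using h2
    have := Finset.sum_congr rfl fun j (_ : j ∈ Finset.univ) => key j
    rw [Finset.sum_add_distrib, ← Finset.mul_sum] at this
    linarith
  · have : 2 * ε ^ 2 ≠ 0 := by positivity
    convert this using 1
    simp only [ContinuousMap.coe_mk, x₀, x₁, x₂, PiLp.add_apply, PiLp.sub_apply,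
      PiLp.single_apply, if_true]
    ring

/-- With at most `d - 2` layers, the first output entry does not depend on the last input entry. -/
theorem not_universalOn_of_add_two_le (σ : ℝ → ℝ) (K : TopologicalSpace.Compacts (Signal c d))
    (hK : (interior (K : Set (Signal c d))).Nonempty) (hc : 1 ≤ c) (hc' : 1 ≤ c') {N : ℕ}
    (hN : N + 2 ≤ d) : ¬ UniversalOn σ K N c' := by
  obtain ⟨x, hx⟩ := hK
  obtain ⟨ε, hε, hεK⟩ := exists_pos_add_single_mem hx
  let p : Fin c × Fin d := (⟨0, hc⟩, ⟨d - 1, by omega⟩)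
  let q : Fin c' × Fin d := (⟨0, hc'⟩, ⟨0, by omega⟩)
  let x₀ : K := ⟨x, interior_subset hx⟩
  let x₁ : K := ⟨_, (hεK p).1⟩
  refine not_universalOn_of_functional (fun g => g x₁ q - g x₀ q) (by fun_prop) ?_
    ⟨fun y => WithLp.toLp 2 fun _ => (y : Signal c d) p, by fun_prop⟩ ?_
  · rintro g ⟨f, hf, hg⟩
    rw [hg, hg, sub_eq_zero]
    refine networks_apply_eq_of_eq hf (r := d - 1) (fun j t ht => ?_) _ _ (by simp only []; omega)
    have : (j, t) ≠ p := fun h => by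
      have := congrArg (fun z => (z.2 : ℕ)) h
      simp only [p] at this
      omega
    simp [x₀, x₁, this]
  · have : ε ≠ 0 := hε.ne'
    convert this using 1
    simp [x₀, x₁]

theorem zeroPadConv_one_three (w : ℤ → ℝ) (y : Fin 3 → ℝ) :
    zeroPadConv 1 w y 0 = w 0 * y 0 + w 1 * y 1 ∧
    zeroPadConv 1 w y 1 = w (-1) * y 0 + w 0 * y 1 + w 1 * y 2 ∧
    zeroPadConv 1 w y 2 = w (-1) * y 1 + w 0 * y 2 := by
  have h0 : zeroPad y 0 = 0 := zeroPad_of_notMem y 0 (by norm_num)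
  have h1 : zeroPad y 1 = y 0 := zeroPad_of_mem y 1 0 (by simp)
  have h2 : zeroPad y 2 = y 1 := zeroPad_of_mem y 2 1 (by simp)
  have h3 : zeroPad y 3 = y 2 := zeroPad_of_mem y 3 2 (by simp)
  have h4 : zeroPad y 4 = 0 := zeroPad_of_notMem y 4 (by norm_num)
  refine ⟨?_, ?_, ?_⟩ <;> rw [zeroPadConv_one_apply] <;> norm_num [h0, h1, h2, h3, h4]

/-- If moving from `y₁` to `y₂` shifts the first two entries by one position, while the vacated
entry is the same as in a constant signal `y₀`, then a layer changes the first entry from `y₀` to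
`y₁` by the same amount as the second entry from `y₀` to `y₂`. -/
theorem convLayer_sub_eq {W : Fin c' → Fin c → ℤ → ℝ} {δ : Fin c' → ℝ} {y₀ y₁ y₂ : Signal c 3}
    (h01 : ∀ j, y₀ (j, 1) = y₀ (j, 0)) (h02 : ∀ j, y₀ (j, 2) = y₀ (j, 0))
    (h1 : ∀ j, y₁ (j, 0) = y₂ (j, 1)) (h2 : ∀ j, y₁ (j, 1) = y₂ (j, 2))
    (h3 : ∀ j, y₂ (j, 0) = y₀ (j, 0)) (i : Fin c') :
    convLayer 1 W δ y₁ (i, 0) - convLayer 1 W δ y₀ (i, 0) =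
      convLayer 1 W δ y₂ (i, 1) - convLayer 1 W δ y₀ (i, 1) := by
  simp only [convLayer_apply, (zeroPadConv_one_three _ _).1, (zeroPadConv_one_three _ _).2.1,
    h01, h02, h1, h2, h3, Finset.sum_add_distrib]
  ring

/-- In dimension three, networks with one or two layers satisfy the linear relation
`f₁(0, ε, 0) - f₁(0) = f₂(0, 0, ε) - f₂(0)`. -/
theorem not_universalOn_three (σ : ℝ → ℝ) (K : TopologicalSpace.Compacts (Signal c 3))
    (hK : 0 ∈ interior (K : Set (Signal c 3))) (hc : 1 ≤ c) (hc' : 1 ≤ c') {N : ℕ}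
    (hN : N < 3) : ¬ UniversalOn σ K N c' := by
  obtain ⟨ε, hε, hεK⟩ := exists_pos_add_single_mem hK
  let i₀ : Fin c := ⟨0, hc⟩
  let q : Fin c' := ⟨0, hc'⟩
  let y₀ : K := ⟨0, interior_subset hK⟩
  let y₁ : K := ⟨_, (hεK (i₀, 1)).1⟩
  let y₂ : K := ⟨_, (hεK (i₀, 2)).1⟩
  have e₀ : ∀ p, (y₀ : Signal c 3) p = 0 := fun p => rfl
  have e₁ : ∀ j t, (y₁ : Signal c 3) (j, t) = if j = i₀ ∧ t = 1 then ε else 0 := fun j t => by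
    simp [y₁]
  have e₂ : ∀ j t, (y₂ : Signal c 3) (j, t) = if j = i₀ ∧ t = 2 then ε else 0 := fun j t => by
    simp [y₂]
  refine not_universalOn_of_functional
    (fun g => g y₁ (q, 0) - g y₀ (q, 0) - (g y₂ (q, 1) - g y₀ (q, 1))) (by fun_prop) ?_
    ⟨fun y => WithLp.toLp 2 fun p => if p.2 = 0 then (y : Signal c 3) (i₀, 1) else 0, by
      refine (PiLp.continuous_toLp 2 _).comp (continuous_pi fun p => ?_)
      split_ifs <;> fun_prop⟩ ?_
  · rintro g ⟨f, hf, hg⟩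
    simp only [hg]
    rw [sub_eq_zero]
    obtain rfl | rfl | rfl : N = 0 ∨ N = 1 ∨ N = 2 := by omega
    · exact absurd hf (Set.notMem_empty f)
    · obtain ⟨W, δ, rfl⟩ := hf
      exact convLayer_sub_eq (by simp [e₀]) (by simp [e₀]) (by simp [e₁, e₂]) (by simp [e₁, e₂])
        (by simp [e₀, e₂]) q
    · obtain ⟨m, _, _, ⟨V, b, rfl⟩, ⟨W, δ, rfl⟩, rfl⟩ := hf
      have hact : ∀ (x : Signal m 3) p, act σ x p = σ (x p) := fun _ _ => rfl
      have hz := fun w : ℤ → ℝ => fun y : Fin 3 → ℝ => zeroPadConv_one_three w y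
      refine convLayer_sub_eq ?_ ?_ ?_ ?_ ?_ q <;> intro j <;>
        simp [hact, convLayer_apply, (hz _ _).1, (hz _ _).2.1, (hz _ _).2.2, e₀, e₁, e₂]
  · have : ε ≠ 0 := hε.ne'
    convert this using 1
    simp [e₀, e₁, e₂]

end LowerBound

end CNN

theorem mainTheorem1 (σ : ℝ → ℝ) (hσ : Continuous σ) (d c c' : ℕ)
    (hd : 1 ≤ d) (hc : 1 ≤ c) (hc' : 1 ≤ c') :
    ((¬ ∃ p : Polynomial ℝ, ∀ t : ℝ, σ t = p.eval t) →
      ∀ K : TopologicalSpace.Compacts (CNN.Signal c d),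
        CNN.UniversalOn σ K (CNN.minDepth d) c') ∧
    (∀ K : TopologicalSpace.Compacts (CNN.Signal c d),
      (interior (K : Set (CNN.Signal c d))).Nonempty →
      (d = 3 → (0 : CNN.Signal c d) ∈ interior (K : Set (CNN.Signal c d))) →
      ∀ N : ℕ, N < CNN.minDepth d → ¬ CNN.UniversalOn σ K N c') := by
  refine ⟨fun hp K => CNN.universalOn_minDepth (σ := ⟨σ, hσ⟩) hp hd K c',
    fun K hK h3 N hN => ?_⟩
  rw [CNN.minDepth] at hN
  split_ifs at hN with h2 hd3
  · obtain rfl | rfl : N = 0 ∨ N = 1 := by omega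
    · exact CNN.not_universalOn_zero σ K
    · exact CNN.not_universalOn_one σ K hK hc hc' hd
  · subst hd3
    exact CNN.not_universalOn_three σ K (h3 rfl) hc hc' hN
  · exact CNN.not_universalOn_of_add_two_le σ K hK hc hc' (by omega)
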